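/- Let $n \ge 0$ be an integer, let $[n] = \{1,\dots,n\}$, and let $\mathcal{A}, \mathcal{B}$ be families of subsets of $[n]$. Suppose that $(\mathcal{A},\mathcal{B})$ is a recovering pair over $[n]$, that is, for all $A, A' \in \mathcal{A}$ and all $B, B' \in \mathcal{B}$, $$A \setminus B = A' \setminus B' \implies A = A' \qquad\text{and}\qquad B \setminus A = B' \setminus A' \implies B = B'.$$ Then $$|\mathcal{A}|\,|\mathcal{B}| \le 2.2543^n.$$ -/

import Mathlib

/-- Two families `𝒜`, `ℬ` of subsets of a finite ground set `X` form a recovering pair over `X` if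
`A \ B` determines `A` and `B \ A` determines `B`, for `A ∈ 𝒜` and `B ∈ ℬ`. -/
def IsRecoveringPair {X : Type*} [DecidableEq X] (𝒜 ℬ : Finset (Finset X)) : Prop :=
  ∀ A ∈ 𝒜, ∀ A' ∈ 𝒜, ∀ B ∈ ℬ, ∀ B' ∈ ℬ,
    (A \ B = A' \ B' → A = A') ∧ (B \ A = B' \ A' → B = B')

/-! Draw `A` and `B` independently and uniformly, and let `p i`, `q i` be the densities of `i` in
the two families. Since `A \ B` determines `A`, and then `B ∩ A`, its entropy is `log #𝒜` plus the
average over `A` of `H(B ∩ A)`; it is at most the sum of `h(p i (1 - q i))`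
(`log_card_add_sum_unifEntropy_le`). If every `p i` were at least `τ`, Shearer's inequality would
bound that average below by `τ log #ℬ`. A coordinate of smaller density costs at most `(τ - p i)(1 -
p i) h(q i)`, because `B` is recoverable from `B \ A` (`mul_log_card_sub_le_sum_unifEntropy_inter`,
`log_card_le_unifEntropy_inter`). Adding the bound for `τ = 1/2` to the one with the families
exchanged leaves an inequality in `p i` and `q i` for each coordinate, `single_letter_le`. -/

open Finset

/-! ### Entropy of functions of a uniform random element -/

section Entropy

variable {Ω β γ δ ε : Type*}

open Classical in
/-- The number of elements of `s` on which `f` takes the same value as at `ω`. -/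
noncomputable def fiberCard (s : Finset Ω) (f : Ω → β) (ω : Ω) : ℕ :=
  #{x ∈ s | f x = f ω}

/-- The Shannon entropy (in nats) of `f ω` for `ω` uniformly distributed on `s`. -/
noncomputable def unifEntropy (s : Finset Ω) (f : Ω → β) : ℝ :=
  (∑ ω ∈ s, (Real.log #s - Real.log (fiberCard s f ω))) / #s

lemma fiberCard_pos {s : Finset Ω} (f : Ω → β) {ω : Ω} (hω : ω ∈ s) : 0 < fiberCard s f ω :=
  card_pos.2 ⟨ω, by simp [hω]⟩

lemma fiberCard_congr {s : Finset Ω} {f : Ω → β} {ω ω' : Ω} (h : f ω = f ω') :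
    fiberCard s f ω = fiberCard s f ω' := by
  rw [fiberCard, fiberCard, h]

lemma fiberCard_le_of_determines {s : Finset Ω} {f : Ω → β} {g : Ω → γ} {ω : Ω}
    (h : ∀ x ∈ s, f x = f ω → g x = g ω) : fiberCard s f ω ≤ fiberCard s g ω := by
  classical
  apply card_le_card
  intro x hx
  simp only [mem_filter] at hx ⊢
  exact ⟨hx.1, h x hx.1 hx.2⟩

lemma unifEntropy_le_of_determines {s : Finset Ω} {f : Ω → β} {g : Ω → γ}
    (h : ∀ ω ∈ s, ∀ x ∈ s, f x = f ω → g x = g ω) : unifEntropy s g ≤ unifEntropy s f := by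
  unfold unifEntropy
  gcongr with ω hω
  · exact_mod_cast fiberCard_pos f hω
  · exact fiberCard_le_of_determines (h ω hω)

lemma unifEntropy_congr {s : Finset Ω} {f : Ω → β} {g : Ω → γ}
    (h : ∀ ω ∈ s, ∀ x ∈ s, f x = f ω ↔ g x = g ω) : unifEntropy s f = unifEntropy s g :=
  le_antisymm (unifEntropy_le_of_determines fun ω hω x hx => (h ω hω x hx).2)
    (unifEntropy_le_of_determines fun ω hω x hx => (h ω hω x hx).1)

lemma unifEntropy_of_injOn {s : Finset Ω} (hs : s.Nonempty) {f : Ω → β} (h : Set.InjOn f s) :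
    unifEntropy s f = Real.log #s := by
  classical
  have h1 : ∀ ω ∈ s, fiberCard s f ω = 1 := by
    intro ω hω
    refine card_eq_one.2 ⟨ω, ?_⟩
    ext x
    simp only [mem_filter, mem_singleton]
    exact ⟨fun hx => h hx.1 hω hx.2, by rintro rfl; exact ⟨hω, rfl⟩⟩
  have h0 : (#s : ℝ) ≠ 0 := by exact_mod_cast hs.card_pos.ne'
  unfold unifEntropy
  rw [sum_congr rfl fun ω hω => by rw [h1 ω hω]]
  simp [h0]

lemma unifEntropy_of_constant {s : Finset Ω} {f : Ω → β} (h : ∀ ω ∈ s, ∀ x ∈ s, f x = f ω) :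
    unifEntropy s f = 0 := by
  classical
  have h1 : ∀ ω ∈ s, fiberCard s f ω = #s := by
    intro ω hω
    rw [fiberCard, filter_true_of_mem (h ω hω)]
  unfold unifEntropy
  rw [sum_congr rfl fun ω hω => by rw [h1 ω hω]]
  simp

/-- Counting form of submodularity. -/
lemma sum_fiberCard_ratio_le {s : Finset Ω} {f : Ω → β} {g : Ω → γ} {j : Ω → δ} {k : Ω → ε}
    (hfk : ∀ ω ∈ s, ∀ x ∈ s, f x = f ω → k x = k ω)
    (hgk : ∀ ω ∈ s, ∀ x ∈ s, g x = g ω → k x = k ω)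
    (hj : ∀ ω ∈ s, ∀ x ∈ s, f x = f ω → g x = g ω → j x = j ω) :
    ∑ ω ∈ s, (fiberCard s f ω * fiberCard s g ω : ℝ) / (fiberCard s j ω * fiberCard s k ω) ≤
      #s := by
  classical
  have expand : ∀ ω ∈ s,
      (fiberCard s f ω * fiberCard s g ω : ℝ) / (fiberCard s j ω * fiberCard s k ω) =
      ∑ x ∈ s, ∑ y ∈ s, if f x = f ω ∧ g y = g ω then
        ((fiberCard s j ω : ℝ) * fiberCard s k ω)⁻¹ else 0 := by
    intro ω _
    have e : (fiberCard s f ω * fiberCard s g ω : ℝ) =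
        ∑ x ∈ s, ∑ y ∈ s, if f x = f ω ∧ g y = g ω then (1 : ℝ) else 0 := by
      simp only [fiberCard, card_filter, Nat.cast_sum, Nat.cast_ite, Nat.cast_one, Nat.cast_zero,
        sum_mul_sum]
      refine sum_congr rfl fun x _ => sum_congr rfl fun y _ => ?_
      by_cases h1 : f x = f ω <;> by_cases h2 : g y = g ω <;> simp [h1, h2]
    rw [e, div_eq_mul_inv, sum_mul]
    refine sum_congr rfl fun x _ => ?_
    rw [sum_mul]
    refine sum_congr rfl fun y _ => ?_
    split_ifs <;> simp
  -- For fixed `x`, `y`, the contributing `ω` share one value of `j` and one of `k`, so there are at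
  -- most `fiberCard s j ω` of them.
  have inner : ∀ x ∈ s, ∀ y ∈ s,
      (∑ ω ∈ s, if f x = f ω ∧ g y = g ω then
        ((fiberCard s j ω : ℝ) * fiberCard s k ω)⁻¹ else 0) ≤
      if k y = k x then ((fiberCard s k x : ℝ))⁻¹ else 0 := by
    intro x hx y hy
    rw [← sum_filter]
    rcases (s.filter fun ω => f x = f ω ∧ g y = g ω).eq_empty_or_nonempty with h0 | ⟨ω₀, h0⟩
    · rw [h0, sum_empty]
      split_ifs <;> positivity
    · have hω₀ := mem_filter.1 h0
      have hkx : k x = k ω₀ := hfk ω₀ hω₀.1 x hx hω₀.2.1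
      have hky : k y = k ω₀ := hgk ω₀ hω₀.1 y hy hω₀.2.2
      rw [if_pos (hky.trans hkx.symm)]
      have hcard : ∀ ω ∈ s.filter (fun ω => f x = f ω ∧ g y = g ω),
          ((fiberCard s j ω : ℝ) * fiberCard s k ω)⁻¹ ≤
            (#(s.filter fun ω => f x = f ω ∧ g y = g ω) : ℝ)⁻¹ * (fiberCard s k x : ℝ)⁻¹ := by
        intro ω hω
        have hω' := mem_filter.1 hω
        have hk : k ω = k x := (hfk ω hω'.1 x hx hω'.2.1).symm
        rw [mul_inv, fiberCard_congr hk]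
        gcongr
        · exact_mod_cast card_pos.2 ⟨ω₀, h0⟩
        · apply card_le_card
          intro z hz
          have hz' := mem_filter.1 hz
          exact mem_filter.2 ⟨hz'.1, hj ω hω'.1 z hz'.1 (hz'.2.1.symm.trans hω'.2.1)
            (hz'.2.2.symm.trans hω'.2.2)⟩
      refine (sum_le_card_nsmul _ _ _ hcard).trans (le_of_eq ?_)
      have : (#(s.filter fun ω => f x = f ω ∧ g y = g ω) : ℝ) ≠ 0 := by
        exact_mod_cast (card_pos.2 ⟨ω₀, h0⟩).ne'
      rw [nsmul_eq_mul, mul_inv_cancel_left₀ this]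
  calc _ = ∑ ω ∈ s, ∑ x ∈ s, ∑ y ∈ s, (if f x = f ω ∧ g y = g ω then
        ((fiberCard s j ω : ℝ) * fiberCard s k ω)⁻¹ else 0) := sum_congr rfl expand
    _ = ∑ x ∈ s, ∑ y ∈ s, ∑ ω ∈ s, (if f x = f ω ∧ g y = g ω then
        ((fiberCard s j ω : ℝ) * fiberCard s k ω)⁻¹ else 0) := by
      rw [sum_comm]
      exact sum_congr rfl fun x _ => sum_comm
    _ ≤ ∑ x ∈ s, ∑ y ∈ s, (if k y = k x then ((fiberCard s k x : ℝ))⁻¹ else 0) :=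
      sum_le_sum fun x hx => sum_le_sum fun y hy => inner x hx y hy
    _ = ∑ x ∈ s, (1 : ℝ) := by
      refine sum_congr rfl fun x hx => ?_
      rw [← sum_filter, sum_const, nsmul_eq_mul]
      have : (fiberCard s k x : ℝ) ≠ 0 := by exact_mod_cast (fiberCard_pos k hx).ne'
      exact mul_inv_cancel₀ this
    _ = #s := by simp

/-- Submodularity of entropy: `H(j) + H(k) ≤ H(f) + H(g)` if `f` and `g` each determine `k` and
together determine `j`. -/
lemma unifEntropy_submodular {s : Finset Ω} {f : Ω → β} {g : Ω → γ} {j : Ω → δ} {k : Ω → ε}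
    (hfk : ∀ ω ∈ s, ∀ x ∈ s, f x = f ω → k x = k ω)
    (hgk : ∀ ω ∈ s, ∀ x ∈ s, g x = g ω → k x = k ω)
    (hj : ∀ ω ∈ s, ∀ x ∈ s, f x = f ω → g x = g ω → j x = j ω) :
    unifEntropy s j + unifEntropy s k ≤ unifEntropy s f + unifEntropy s g := by
  have h := sum_fiberCard_ratio_le hfk hgk hj
  unfold unifEntropy
  rw [← add_div, ← add_div, ← sum_add_distrib, ← sum_add_distrib]
  refine div_le_div_of_nonneg_right ?_ (Nat.cast_nonneg _)
  rw [← sub_nonpos, ← sum_sub_distrib]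
  -- Pointwise `log t ≤ t - 1`, with `t` the fibre ratio just averaged.
  have hle : ∀ ω ∈ s, (Real.log #s - Real.log (fiberCard s j ω) +
      (Real.log #s - Real.log (fiberCard s k ω)) - (Real.log #s - Real.log (fiberCard s f ω) +
      (Real.log #s - Real.log (fiberCard s g ω)))) ≤
      (fiberCard s f ω * fiberCard s g ω : ℝ) / (fiberCard s j ω * fiberCard s k ω) - 1 := by
    intro ω hω
    have pf : (0 : ℝ) < fiberCard s f ω := by exact_mod_cast fiberCard_pos f hω
    have pg : (0 : ℝ) < fiberCard s g ω := by exact_mod_cast fiberCard_pos g hω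
    have pj : (0 : ℝ) < fiberCard s j ω := by exact_mod_cast fiberCard_pos j hω
    have pk : (0 : ℝ) < fiberCard s k ω := by exact_mod_cast fiberCard_pos k hω
    have hlog := Real.log_le_sub_one_of_pos (div_pos (mul_pos pf pg) (mul_pos pj pk))
    rw [Real.log_div (mul_pos pf pg).ne' (mul_pos pj pk).ne', Real.log_mul pf.ne' pg.ne',
      Real.log_mul pj.ne' pk.ne'] at hlog
    linarith
  refine (sum_le_sum hle).trans ?_
  rw [sum_sub_distrib]
  simpa using h

lemma unifEntropy_subadditive {s : Finset Ω} {f : Ω → β} {g : Ω → γ} {j : Ω → δ}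
    (hj : ∀ ω ∈ s, ∀ x ∈ s, f x = f ω → g x = g ω → j x = j ω) :
    unifEntropy s j ≤ unifEntropy s f + unifEntropy s g := by
  have h := unifEntropy_submodular (k := fun _ => ()) (fun _ _ _ _ _ => rfl)
    (fun _ _ _ _ _ => rfl) hj
  rwa [unifEntropy_of_constant (f := fun _ : Ω => ()) fun _ _ _ _ => rfl, add_zero] at h

/-- The entropy of an event is the binary entropy of its probability. -/
lemma unifEntropy_prop (s : Finset Ω) (P : Ω → Prop) [DecidablePred P] :
    unifEntropy s P = Real.binEntropy ((#{ω ∈ s | P ω} : ℝ) / #s) := by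
  classical
  rcases s.eq_empty_or_nonempty with rfl | hs
  · simp [unifEntropy]
  have hN : (#s : ℝ) ≠ 0 := by exact_mod_cast hs.card_pos.ne'
  have hsum : (#{ω ∈ s | P ω} : ℝ) + #{ω ∈ s | ¬ P ω} = #s := by
    exact_mod_cast card_filter_add_card_filter_not P
  have hfib : ∀ ω ∈ s, Real.log #s - Real.log (fiberCard s P ω) =
      if P ω then Real.log #s - Real.log #{ω ∈ s | P ω}
      else Real.log #s - Real.log #{ω ∈ s | ¬ P ω} := by
    intro ω _
    split_ifs with h <;> simp [fiberCard, h]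
  have hone : 1 - (#{ω ∈ s | P ω} : ℝ) / #s = (#{ω ∈ s | ¬ P ω} : ℝ) / #s := by
    rw [← hsum] at hN ⊢
    field_simp
    ring
  have hterm : ∀ a : ℝ, a * (Real.log #s - Real.log a) / #s = a / #s * Real.log (a / #s)⁻¹ := by
    intro a
    rcases eq_or_ne a 0 with rfl | ha
    · simp
    · rw [Real.log_inv, Real.log_div ha hN]
      ring
  rw [Real.binEntropy, hone, unifEntropy, sum_congr rfl hfib, sum_ite, sum_const, sum_const,
    nsmul_eq_mul, nsmul_eq_mul, add_div, hterm, hterm]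

/-- Chain rule for a pair of independent uniform variables. -/
lemma unifEntropy_product {Ω' : Type*} {s : Finset Ω} {t : Finset Ω'} (hs : s.Nonempty)
    (ht : t.Nonempty) {j : Ω × Ω' → β} {g : Ω → Ω' → γ}
    (h : ∀ a ∈ s, ∀ b ∈ t, ∀ a' ∈ s, ∀ b' ∈ t, j (a', b') = j (a, b) ↔ a' = a ∧ g a b' = g a b) :
    unifEntropy (s ×ˢ t) j = Real.log #s + (∑ a ∈ s, unifEntropy t (g a)) / #s := by
  classical
  have hS : (#s : ℝ) ≠ 0 := by exact_mod_cast hs.card_pos.ne'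
  have hT : (#t : ℝ) ≠ 0 := by exact_mod_cast ht.card_pos.ne'
  have hfib : ∀ a ∈ s, ∀ b ∈ t, fiberCard (s ×ˢ t) j (a, b) = fiberCard t (g a) b := by
    intro a ha b hb
    have : {x ∈ s ×ˢ t | j x = j (a, b)} = {a} ×ˢ {y ∈ t | g a y = g a b} := by
      ext ⟨a', b'⟩
      simp only [mem_filter, mem_product, mem_singleton]
      constructor
      · rintro ⟨⟨h1, h2⟩, h3⟩
        have := (h a ha b hb a' h1 b' h2).1 h3
        exact ⟨this.1, h2, this.2⟩
      · rintro ⟨rfl, h2, h3⟩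
        exact ⟨⟨ha, h2⟩, (h a' ha b hb a' ha b' h2).2 ⟨rfl, h3⟩⟩
    rw [fiberCard, fiberCard, this, card_product, card_singleton, one_mul]
  have hinner : ∀ a ∈ s, ∑ b ∈ t, (Real.log #(s ×ˢ t) - Real.log (fiberCard (s ×ˢ t) j (a, b))) =
      #t * Real.log #s + #t * unifEntropy t (g a) := by
    intro a ha
    rw [unifEntropy, mul_div_cancel₀ _ hT, sum_congr rfl fun b hb => by rw [hfib a ha b hb],
      card_product, Nat.cast_mul, Real.log_mul hS hT, sum_sub_distrib, sum_sub_distrib,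
      sum_const, sum_const, nsmul_eq_mul, nsmul_eq_mul]
    ring
  rw [unifEntropy, sum_product, sum_congr rfl hinner, sum_add_distrib, sum_const, ← mul_sum,
    card_product, nsmul_eq_mul, Nat.cast_mul]
  field_simp

/-- A random set is determined by its trace on `U` and its membership bits on `V`. -/
lemma unifEntropy_inter_union_le {ι : Type*} [DecidableEq ι] (s : Finset Ω) (F : Ω → Finset ι)
    (U V : Finset ι) :
    unifEntropy s (fun ω => F ω ∩ (U ∪ V)) ≤
      unifEntropy s (fun ω => F ω ∩ U) + ∑ i ∈ V, unifEntropy s (fun ω => i ∈ F ω) := by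
  induction V using Finset.induction_on with
  | empty => simp
  | insert a V ha ih =>
    rw [sum_insert ha]
    have h : unifEntropy s (fun ω => F ω ∩ (U ∪ insert a V)) ≤
        unifEntropy s (fun ω => F ω ∩ (U ∪ V)) + unifEntropy s (fun ω => a ∈ F ω) := by
      apply unifEntropy_subadditive
      intro ω _ x _ h1 h2
      ext i
      have h1' := Finset.ext_iff.1 h1 i
      simp only [mem_inter, mem_union, mem_insert] at h1' ⊢
      by_cases hi : i = a
      · subst hi
        simp [h2]
      · simpa [hi] using h1'
    linarith

end Entropy

/-! ### Binary entropy estimates and the single-letter inequality -/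

/-- The logarithm bound behind the quartic estimate of the binary entropy. -/
lemma two_mul_add_cube_le_log_sub_log {x : ℝ} (h0 : 0 ≤ x) (h1 : x < 1) :
    2 * x + 2 / 3 * x ^ 3 ≤ Real.log (1 + x) - Real.log (1 - x) := by
  have h := Real.hasSum_log_sub_log_of_abs_lt_one (abs_lt.2 ⟨by linarith, h1⟩)
  have h2 := sum_le_hasSum (Finset.range 2) (fun i _ => by positivity) h
  norm_num [Finset.sum_range_succ] at h2
  linarith

/-- Equality holds at `y = 0`, and the derivative of the left side, `log (1 - 2y) - log (1 + 2y)`,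
is at most that of the right. -/
lemma binEntropy_half_add_le_of_nonneg {y : ℝ} (h0 : 0 ≤ y) (h1 : y ≤ 1 / 2) :
    Real.binEntropy (1 / 2 + y) ≤ Real.log 2 - 2 * y ^ 2 - 4 / 3 * y ^ 4 := by
  have hanti : AntitoneOn
      (fun y : ℝ => Real.binEntropy (1 / 2 + y) + 2 * y ^ 2 + 4 / 3 * y ^ 4)
      (Set.Icc 0 (1 / 2)) := by
    have hderiv : ∀ y ∈ interior (Set.Icc (0 : ℝ) (1 / 2)), HasDerivAt
        (fun y : ℝ => Real.binEntropy (1 / 2 + y) + 2 * y ^ 2 + 4 / 3 * y ^ 4)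
        ((Real.log (1 - (1 / 2 + y)) - Real.log (1 / 2 + y)) * 1 + 2 * (2 * y) +
          4 / 3 * (4 * y ^ 3)) y := by
      intro y hy
      rw [interior_Icc] at hy
      have hb : HasDerivAt Real.binEntropy
          (Real.log (1 - (1 / 2 + y)) - Real.log (1 / 2 + y)) (1 / 2 + y) :=
        Real.hasDerivAt_binEntropy (by linarith [hy.1]) (by linarith [hy.2])
      have hc := hb.comp y ((hasDerivAt_id y).const_add (1 / 2))
      have h2 := (hasDerivAt_pow 2 y).const_mul 2
      have h4 := (hasDerivAt_pow 4 y).const_mul (4 / 3)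
      norm_num at h2 h4
      exact (hc.add h2).add h4
    refine antitoneOn_of_deriv_nonpos (convex_Icc _ _) ?_ ?_ ?_
    · exact (((Real.binEntropy_continuous.comp (continuous_const.add continuous_id)).add
        (continuous_const.mul (continuous_pow 2))).add
        (continuous_const.mul (continuous_pow 4))).continuousOn
    · intro y hy
      exact (hderiv y hy).differentiableAt.differentiableWithinAt
    · intro y hy
      rw [(hderiv y hy).deriv]
      rw [interior_Icc] at hy
      obtain ⟨hy0, hy1⟩ := hy
      have h := two_mul_add_cube_le_log_sub_log (x := 2 * y) (by linarith) (by linarith)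
      have e1 : Real.log (1 - (1 / 2 + y)) = Real.log (1 - 2 * y) - Real.log 2 := by
        rw [← Real.log_div (by linarith) (by norm_num)]
        congr 1
        ring
      have e2 : Real.log (1 / 2 + y) = Real.log (1 + 2 * y) - Real.log 2 := by
        rw [← Real.log_div (by linarith) (by norm_num)]
        congr 1
        ring
      rw [e1, e2]
      nlinarith
  have h := hanti ⟨le_rfl, by norm_num⟩ ⟨h0, h1⟩ h0
  have hz : Real.binEntropy (1 / 2) = Real.log 2 := by
    rw [one_div, Real.binEntropy_two_inv]
  norm_num at h hz
  rw [hz] at h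
  linarith

/-- Truncation of the Taylor series of the binary entropy at `1 / 2`. -/
lemma binEntropy_half_sub_le {y : ℝ} (h0 : -(1 / 2) ≤ y) (h1 : y ≤ 1 / 2) :
    Real.binEntropy (1 / 2 - y) ≤ Real.log 2 - 2 * y ^ 2 - 4 / 3 * y ^ 4 := by
  rcases le_total 0 y with h | h
  · rw [← Real.binEntropy_one_sub, show 1 - (1 / 2 - y) = 1 / 2 + y by ring]
    exact binEntropy_half_add_le_of_nonneg h h1
  · have := binEntropy_half_add_le_of_nonneg (y := -y) (by linarith) (by linarith)
    rw [← sub_eq_add_neg] at this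
    convert this using 3 <;> ring

/-- This is `2 ^ 34 ≤ 2.2543 ^ 29`; it turns the target `3/2 log 2.2543` into `51/29 log 2`. -/
lemma log_two_mul_le_log : 34 / 29 * Real.log 2 ≤ Real.log 2.2543 := by
  have h : Real.log ((2 : ℝ) ^ 34) ≤ Real.log ((2.2543 : ℝ) ^ 29) :=
    Real.log_le_log (by positivity) (by norm_num)
  rw [Real.log_pow, Real.log_pow] at h
  push_cast at h
  linarith

/-- The sum of the entropy bounds of `p (1 - q)` and `q (1 - p)`, in terms of `α = 1 / 2 - q` and
`β = 1 / 2 - p`. -/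
lemma binEntropy_add_binEntropy_le {α β : ℝ} (hα : -(1 / 2) ≤ α) (hα' : α ≤ 1 / 2)
    (hβ : -(1 / 2) ≤ β) (hβ' : β ≤ 1 / 2) :
    Real.binEntropy ((1 / 2 - β) * (1 / 2 + α)) + Real.binEntropy ((1 / 2 - α) * (1 / 2 + β)) ≤
      2 * Real.log 2 - (1 / 4 + α ^ 2 + β ^ 2 + 4 * α ^ 2 * β ^ 2) -
        8 / 3 * ((1 / 4 + α * β) ^ 4 + 3 / 2 * (1 / 4 + α * β) ^ 2 * (α - β) ^ 2 +
          (α - β) ^ 4 / 16) := by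
  have bounds : ∀ x y : ℝ, -(1 / 2) ≤ x → x ≤ 1 / 2 → -(1 / 2) ≤ y → y ≤ 1 / 2 →
      0 ≤ (1 / 2 - y) * (1 / 2 + x) ∧ (1 / 2 - y) * (1 / 2 + x) ≤ 1 := fun x y hx hx' hy hy' =>
    ⟨mul_nonneg (by linarith) (by linarith), mul_le_one₀ (by linarith) (by linarith) (by linarith)⟩
  obtain ⟨s0, s1⟩ := bounds α β hα hα' hβ hβ'
  obtain ⟨t0, t1⟩ := bounds β α hβ hβ' hα hα'
  -- The two offsets from `1/2` are `m - d` and `m + d`, where `m = 1/4 + α β` and `d = (α - β)/2`,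
  -- so odd powers of `d` cancel in the sum.
  have hs := binEntropy_half_sub_le (y := 1 / 2 - (1 / 2 - β) * (1 / 2 + α))
    (by linarith) (by linarith)
  have ht := binEntropy_half_sub_le (y := 1 / 2 - (1 / 2 - α) * (1 / 2 + β))
    (by linarith) (by linarith)
  rw [sub_sub_cancel] at hs ht
  refine (add_le_add hs ht).trans (le_of_eq ?_)
  ring

lemma entropy_sum_le_of_nonneg {α β l : ℝ} (hα : 0 ≤ α) (hα' : α ≤ 1 / 2) (hβ : 0 ≤ β)
    (hβ' : β ≤ 1 / 2) (hl : 0.6931471803 < l) (hl' : l < 0.6931471808) :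
    2 * l - (1 / 4 + α ^ 2 + β ^ 2 + 4 * α ^ 2 * β ^ 2) -
        8 / 3 * ((1 / 4 + α * β) ^ 4 + 3 / 2 * (1 / 4 + α * β) ^ 2 * (α - β) ^ 2 +
          (α - β) ^ 4 / 16) +
      (1 / 2 + β) * β * (l - 2 * α ^ 2) + (1 / 2 + α) * α * (l - 2 * β ^ 2) ≤
        51 / 29 * l := by
  have hw : 0 ≤ α * β := mul_nonneg hα hβ
  obtain ⟨σ, hσ⟩ : ∃ σ, α + β = σ := ⟨_, rfl⟩
  obtain ⟨w, hw'⟩ : ∃ w, α * β = w := ⟨_, rfl⟩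
  rw [hw'] at hw ⊢
  have e1 : (α - β) ^ 2 = σ ^ 2 - 4 * w := by rw [← hσ, ← hw']; ring
  have h1 : 1 / 256 + w / 16 + 3 / 8 * w ^ 2 ≤ (1 / 4 + w) ^ 4 := by
    have : (1 / 4 + w) ^ 4 = 1 / 256 + w / 16 + 3 / 8 * w ^ 2 + w ^ 3 + w ^ 4 := by ring
    rw [this]
    linarith [pow_nonneg hw 3, pow_nonneg hw 4]
  have h2 : 1 / 16 * (σ ^ 2 - 4 * w) ≤ (1 / 4 + w) ^ 2 * (α - β) ^ 2 := by
    rw [← e1]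
    exact mul_le_mul_of_nonneg_right (by nlinarith) (sq_nonneg _)
  have h3 : 0 ≤ (α - β) ^ 4 := by positivity
  have e2 : (1 / 2 + β) * β * (l - 2 * α ^ 2) + (1 / 2 + α) * α * (l - 2 * β ^ 2) =
      l * (σ / 2 + σ ^ 2 - 2 * w) - w * σ - 4 * w ^ 2 := by
    rw [← hσ, ← hw']; ring
  have e3 : 1 / 4 + α ^ 2 + β ^ 2 + 4 * α ^ 2 * β ^ 2 = 1 / 4 + σ ^ 2 - 2 * w + 4 * w ^ 2 := by
    rw [← hσ, ← hw']; ring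
  have h4 : 4 * w ≤ σ ^ 2 := by nlinarith [sq_nonneg (α - β)]
  have hσ0 : 0 ≤ σ := by linarith
  have hσ1 : σ ≤ 1 := by linarith
  have e4 : 0 ≤ σ / 2 + σ ^ 2 - 2 * w := by nlinarith
  have h5 : l * (σ / 2 + σ ^ 2 - 2 * w) ≤ 0.6931471808 * (σ / 2 + σ ^ 2 - 2 * w) :=
    mul_le_mul_of_nonneg_right hl'.le e4
  have key : 7 / 29 * 0.6931471808 - 1 / 4 - 1 / 96 + 0.6931471808 * (σ / 2 + σ ^ 2 - 2 * w) -
      5 / 4 * σ ^ 2 + 17 / 6 * w - 9 * w ^ 2 - w * σ ≤ 0 := by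
    -- The first square completes the quadratic in `w`, the second what then remains in `σ`; the
    -- centres are rounded.
    nlinarith [sq_nonneg (w + σ / 18 - 0.0804), sq_nonneg (σ - 0.2515)]
  rw [add_assoc, e2, e3, mul_assoc (3 / 2 : ℝ)]
  linarith

lemma entropy_sum_le_of_nonpos_of_nonneg {α β l : ℝ} (hα : 0 ≤ α) (hα' : α ≤ 1 / 2) (hβ : β ≤ 0)
    (hβ' : -(1 / 2) ≤ β) (hl : 0.6931471803 < l) (hl' : l < 0.6931471808) :
    2 * l - (1 / 4 + α ^ 2 + β ^ 2 + 4 * α ^ 2 * β ^ 2) -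
        8 / 3 * ((1 / 4 + α * β) ^ 4 + 3 / 2 * (1 / 4 + α * β) ^ 2 * (α - β) ^ 2 +
          (α - β) ^ 4 / 16) + (1 / 2 + α) * α * (l - 2 * β ^ 2) ≤ 51 / 29 * l := by
  have h0 : α ^ 4 ≤ (α - β) ^ 4 := by gcongr; linarith
  have h1 : 0 ≤ (1 / 4 + α * β) ^ 4 + 3 / 2 * (1 / 4 + α * β) ^ 2 * (α - β) ^ 2 := by positivity
  have h2 : (1 / 2 + α) * α * (l - 2 * β ^ 2) ≤ (1 / 2 + α) * α * 0.6931471808 := by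
    apply mul_le_mul_of_nonneg_left _ (by positivity)
    nlinarith [sq_nonneg β]
  have h3 : 0 ≤ α ^ 2 * β ^ 2 := by positivity
  nlinarith [sq_nonneg (α ^ 2 - 0.15), sq_nonneg (α - 0.4), sq_nonneg β]

/-- The single-letter inequality. -/
lemma single_letter_le {p q : ℝ} (hp : 0 ≤ p) (hp' : p ≤ 1) (hq : 0 ≤ q) (hq' : q ≤ 1) :
    Real.binEntropy (p * (1 - q)) + Real.binEntropy (q * (1 - p)) +
      max (1 / 2 - p) 0 * ((1 - p) * Real.binEntropy q) +
      max (1 / 2 - q) 0 * ((1 - q) * Real.binEntropy p) ≤ 3 / 2 * Real.log 2.2543 := by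
  obtain ⟨α, rfl⟩ : ∃ α, q = 1 / 2 - α := ⟨1 / 2 - q, by ring⟩
  obtain ⟨β, rfl⟩ : ∃ β, p = 1 / 2 - β := ⟨1 / 2 - p, by ring⟩
  have hsum := binEntropy_add_binEntropy_le (α := α) (β := β)
    (by linarith) (by linarith) (by linarith) (by linarith)
  have hlog := log_two_mul_le_log
  have hl := Real.log_two_gt_d9
  have hl' := Real.log_two_lt_d9
  have quad : ∀ x : ℝ, -(1 / 2) ≤ x → x ≤ 1 / 2 →
      Real.binEntropy (1 / 2 - x) ≤ Real.log 2 - 2 * x ^ 2 := fun x hx hx' =>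
    (binEntropy_half_sub_le hx hx').trans (by nlinarith [sq_nonneg (x ^ 2)])
  have term : ∀ x y : ℝ, 0 ≤ x → -(1 / 2) ≤ y → y ≤ 1 / 2 →
      x * ((1 / 2 + x) * Real.binEntropy (1 / 2 - y)) ≤
        (1 / 2 + x) * x * (Real.log 2 - 2 * y ^ 2) := fun x y hx hy hy' => by
    rw [← mul_assoc, mul_comm x]
    exact mul_le_mul_of_nonneg_left (quad y hy hy') (by positivity)
  have e : ∀ x : ℝ, 1 / 2 - (1 / 2 - x) = x := fun x => by ring
  have e' : ∀ x : ℝ, 1 - (1 / 2 - x) = 1 / 2 + x := fun x => by ring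
  rw [e, e, e', e']
  rcases le_total 0 α with hα | hα <;> rcases le_total 0 β with hβ | hβ
  · rw [max_eq_left hα, max_eq_left hβ]
    linarith [term α β hα (by linarith) (by linarith), term β α hβ (by linarith) (by linarith),
      entropy_sum_le_of_nonneg hα (by linarith) hβ (by linarith) hl hl']
  · rw [max_eq_left hα, max_eq_right hβ]
    linarith [term α β hα (by linarith) (by linarith),
      entropy_sum_le_of_nonpos_of_nonneg hα (by linarith) hβ (by linarith) hl hl']
  · rw [max_eq_right hα, max_eq_left hβ]
    have h := entropy_sum_le_of_nonpos_of_nonneg hβ (by linarith) hα (by linarith) hl hl'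
    rw [mul_comm β α, ← neg_sub α β, neg_sq, Even.neg_pow (by decide : Even 4)] at h
    linarith [term β α hβ (by linarith) (by linarith)]
  · rw [max_eq_right hα, max_eq_right hβ]
    have h1 : 0 ≤ (1 / 4 + α * β) ^ 4 + 3 / 2 * (1 / 4 + α * β) ^ 2 * (α - β) ^ 2 +
        (α - β) ^ 4 / 16 := by positivity
    have h2 : 0 ≤ α ^ 2 + β ^ 2 + 4 * α ^ 2 * β ^ 2 := by positivity
    linarith

/-! ### Entropy inequalities for recovering pairs -/

section RecoveringPairs

variable {ι : Type*} [DecidableEq ι]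

/-- The proportion of members of `𝒜` that contain `i`. -/
noncomputable def memDensity (𝒜 : Finset (Finset ι)) (i : ι) : ℝ :=
  (#{A ∈ 𝒜 | i ∈ A} : ℝ) / #𝒜

lemma memDensity_nonneg (𝒜 : Finset (Finset ι)) (i : ι) : 0 ≤ memDensity 𝒜 i := by
  unfold memDensity
  positivity

lemma memDensity_le_one (𝒜 : Finset (Finset ι)) (i : ι) : memDensity 𝒜 i ≤ 1 := by
  apply div_le_one_of_le₀ _ (Nat.cast_nonneg _)
  exact_mod_cast card_filter_le _ _

lemma unifEntropy_mem (ℬ : Finset (Finset ι)) (i : ι) :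
    unifEntropy ℬ (fun B => i ∈ B) = Real.binEntropy (memDensity ℬ i) :=
  unifEntropy_prop ℬ _

lemma sum_ite_notMem_eq {𝒜 : Finset (Finset ι)} (h𝒜 : 𝒜.Nonempty) (i : ι) (c : ℝ) :
    (∑ A ∈ 𝒜, if i ∈ A then 0 else c) / #𝒜 = (1 - memDensity 𝒜 i) * c := by
  have h0 : (#𝒜 : ℝ) ≠ 0 := by exact_mod_cast h𝒜.card_pos.ne'
  have hsum : (#{A ∈ 𝒜 | i ∈ A} : ℝ) + #{A ∈ 𝒜 | i ∉ A} = #𝒜 := by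
    exact_mod_cast card_filter_add_card_filter_not (s := 𝒜) (fun A => i ∈ A)
  rw [sum_ite, sum_const_zero, zero_add, sum_const, nsmul_eq_mul, memDensity]
  field_simp
  linear_combination c * hsum

/-- If every `B ∈ ℬ` is determined by `B \ A`, for each `A ∈ 𝒜`, then the trace of `ℬ` on `U`
misses at most `(1 - p i) h(q i)` of the entropy per element `i` outside `U`. -/
lemma log_card_le_unifEntropy_inter [Fintype ι] {𝒜 ℬ : Finset (Finset ι)} (h𝒜 : 𝒜.Nonempty)
    (hℬ : ℬ.Nonempty) (h : ∀ A ∈ 𝒜, ∀ B ∈ ℬ, ∀ B' ∈ ℬ, B \ A = B' \ A → B = B') (U : Finset ι) :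
    Real.log #ℬ ≤ unifEntropy ℬ (fun B => B ∩ U) +
      ∑ i ∈ Uᶜ, (1 - memDensity 𝒜 i) * Real.binEntropy (memDensity ℬ i) := by
  have h0 : (0 : ℝ) < #𝒜 := by exact_mod_cast h𝒜.card_pos
  -- For fixed `A`, no `i ∈ A` costs anything, as it never lies in `B \ A`; averaging over `A`
  -- yields the factor `1 - p i`.
  have hA : ∀ A ∈ 𝒜, Real.log #ℬ ≤ unifEntropy ℬ (fun B => B ∩ U) +
      ∑ i ∈ Uᶜ, if i ∈ A then 0 else Real.binEntropy (memDensity ℬ i) := by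
    intro A hA
    have h1 : unifEntropy ℬ (fun B => B \ A) = Real.log #ℬ :=
      unifEntropy_of_injOn hℬ fun B hB B' hB' e => h A hA B hB B' hB' e
    have h2 := unifEntropy_inter_union_le ℬ (fun B => B \ A) U Uᶜ
    simp only [union_compl, inter_univ] at h2
    have h3 : unifEntropy ℬ (fun B => (B \ A) ∩ U) ≤ unifEntropy ℬ (fun B => B ∩ U) := by
      apply unifEntropy_le_of_determines
      intro B _ B' _ e
      rw [sdiff_inter_right_comm, sdiff_inter_right_comm, e]
    have h4 : ∀ i ∈ Uᶜ, unifEntropy ℬ (fun B => i ∈ B \ A) =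
        if i ∈ A then 0 else Real.binEntropy (memDensity ℬ i) := by
      intro i _
      split_ifs with hi
      · apply unifEntropy_of_constant
        simp [hi]
      · rw [← unifEntropy_mem]
        apply unifEntropy_congr
        simp [hi]
    rw [sum_congr rfl h4, h1] at h2
    linarith
  have hsum := sum_le_sum hA
  rw [sum_const, nsmul_eq_mul, sum_add_distrib, sum_const, nsmul_eq_mul, sum_comm] at hsum
  rw [← sum_congr rfl fun i _ => sum_ite_notMem_eq h𝒜 i (Real.binEntropy (memDensity ℬ i)),
    ← sum_div, ← sub_le_iff_le_add', le_div_iff₀ h0]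
  linarith

/-- Inserting `a` into `U` raises the average entropy of the trace of `ℬ` on `A ∩ U`, over `A ∈ 𝒜`,
by at least the density of `a` times the entropy gain of the trace on `U`. -/
lemma sum_unifEntropy_inter_insert_le {𝒜 : Finset (Finset ι)} (h𝒜 : 𝒜.Nonempty)
    (ℬ : Finset (Finset ι)) (U : Finset ι) (a : ι) :
    (∑ A ∈ 𝒜, unifEntropy ℬ (fun B => B ∩ (A ∩ U))) / #𝒜 + memDensity 𝒜 a *
      (unifEntropy ℬ (fun B => B ∩ insert a U) - unifEntropy ℬ (fun B => B ∩ U)) ≤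
    (∑ A ∈ 𝒜, unifEntropy ℬ (fun B => B ∩ (A ∩ insert a U))) / #𝒜 := by
  have h0 : (0 : ℝ) < #𝒜 := by exact_mod_cast h𝒜.card_pos
  set c := unifEntropy ℬ (fun B => B ∩ insert a U) - unifEntropy ℬ (fun B => B ∩ U) with hc
  have hA : ∀ A ∈ 𝒜, unifEntropy ℬ (fun B => B ∩ (A ∩ U)) + (if a ∈ A then c else 0) ≤
      unifEntropy ℬ (fun B => B ∩ (A ∩ insert a U)) := by
    intro A _
    split_ifs with ha
    -- As `a ∈ A`, the sets `A ∩ insert a U` and `U` have union `insert a U` and intersection `A ∩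
    -- U`.
    · have := unifEntropy_submodular (s := ℬ) (f := fun B => B ∩ (A ∩ insert a U))
        (g := fun B => B ∩ U) (j := fun B => B ∩ insert a U) (k := fun B => B ∩ (A ∩ U)) ?_ ?_ ?_
      · linarith
      all_goals
        intro B _ B' _ e
        simp only [Finset.ext_iff, mem_inter, mem_insert] at e ⊢
        grind
    · rw [add_zero, inter_insert_of_notMem ha]
  have hsum := sum_le_sum hA
  rw [sum_add_distrib, sum_ite, sum_const_zero, add_zero, sum_const, nsmul_eq_mul] at hsum
  rw [memDensity, div_mul_eq_mul_div, ← add_div]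
  exact div_le_div_of_nonneg_right hsum h0.le

/-- A weighted Shearer inequality, obtained by ordering the ground set by decreasing density
in `𝒜`. -/
lemma mul_log_card_sub_le_sum_unifEntropy_inter [Fintype ι] {𝒜 ℬ : Finset (Finset ι)}
    (h𝒜 : 𝒜.Nonempty) {g : ι → ℝ}
    (hg : ∀ U, Real.log #ℬ ≤ unifEntropy ℬ (fun B => B ∩ U) + ∑ i ∈ Uᶜ, g i)
    {τ : ℝ} (hτ : 0 ≤ τ) :
    τ * Real.log #ℬ - ∑ i, max (τ - memDensity 𝒜 i) 0 * g i ≤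
      (∑ A ∈ 𝒜, unifEntropy ℬ (fun B => B ∩ A)) / #𝒜 := by
  have hg' : ∀ U, Real.log #ℬ - ∑ i, g i + ∑ i ∈ U, g i ≤ unifEntropy ℬ (fun B => B ∩ U) := by
    intro U
    have h := hg U
    rw [← sum_add_sum_compl U g]
    linarith
  -- Weight `m` stays on the true entropy of the trace, and `τ - m` goes to its lower bound `hg'`.
  -- Elements enter in decreasing density, so `m` can fall with the density; `U = univ`, `m = 0` is
  -- the claim.
  have key : ∀ U : Finset ι, ∀ m : ℝ, m ≤ τ → (∀ x ∈ U, m ≤ memDensity 𝒜 x) →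
      m * unifEntropy ℬ (fun B => B ∩ U) + (τ - m) * (Real.log #ℬ - ∑ i, g i + ∑ i ∈ U, g i) -
        ∑ i ∈ U, max (τ - memDensity 𝒜 i) 0 * g i ≤
      (∑ A ∈ 𝒜, unifEntropy ℬ (fun B => B ∩ (A ∩ U))) / #𝒜 := by
    intro U
    induction U using Finset.induction_on_min_value (memDensity 𝒜) with
    | empty =>
      intro m hm _
      have hzero : unifEntropy ℬ (fun B => B ∩ ∅) = 0 :=
        unifEntropy_of_constant (by simp)
      have h := hg' ∅
      simp only [inter_empty] at hzero h ⊢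
      rw [hzero] at h ⊢
      simp only [sum_empty, sum_const_zero, zero_div] at h ⊢
      nlinarith
    | insert a U ha hmin ih =>
      intro m hm hx
      have hma : m ≤ memDensity 𝒜 a := hx a (mem_insert_self a U)
      have hstep := sum_unifEntropy_inter_insert_le h𝒜 ℬ U a
      have hU := ih (min τ (memDensity 𝒜 a)) (min_le_left _ _)
        fun x hx' => (min_le_right _ _).trans (hmin x hx')
      have hmono : unifEntropy ℬ (fun B => B ∩ U) ≤ unifEntropy ℬ (fun B => B ∩ insert a U) := by
        apply unifEntropy_le_of_determines
        intro B _ B' _ e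
        simp only [Finset.ext_iff, mem_inter, mem_insert] at e ⊢
        grind
      have hfull := hg' (insert a U)
      rw [sum_insert ha] at hfull
      rw [sum_insert ha, sum_insert ha]
      have hmax : max (τ - memDensity 𝒜 a) 0 = τ - min τ (memDensity 𝒜 a) := by
        rcases le_total τ (memDensity 𝒜 a) with h | h
        · rw [max_eq_right (by linarith), min_eq_left h, sub_self]
        · rw [max_eq_left (by linarith), min_eq_right h]
      rw [hmax]
      have h1 : m ≤ min τ (memDensity 𝒜 a) := le_min hm hma
      have h2 : min τ (memDensity 𝒜 a) ≤ memDensity 𝒜 a := min_le_right _ _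
      generalize min τ (memDensity 𝒜 a) = m' at *
      -- The gain has factor at least `m'` by `h3`; `h4` then shifts weight `m' - m` from the true
      -- entropy to its lower bound.
      have h3 := mul_le_mul_of_nonneg_right h2 (sub_nonneg.2 hmono)
      have h4 := mul_le_mul_of_nonneg_right h1 (sub_nonneg.2 hfull)
      linarith
  have h := key univ 0 hτ fun x _ => memDensity_nonneg 𝒜 x
  simp only [inter_univ] at h
  linarith

/-- The members of `𝒜` are recovered from the differences `A \ B`, whose entropy is subadditive. -/
lemma log_card_add_sum_unifEntropy_le [Fintype ι] {𝒜 ℬ : Finset (Finset ι)} (h𝒜 : 𝒜.Nonempty)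
    (hℬ : ℬ.Nonempty)
    (h : ∀ A ∈ 𝒜, ∀ A' ∈ 𝒜, ∀ B ∈ ℬ, ∀ B' ∈ ℬ, A \ B = A' \ B' → A = A') :
    Real.log #𝒜 + (∑ A ∈ 𝒜, unifEntropy ℬ (fun B => B ∩ A)) / #𝒜 ≤
      ∑ i, Real.binEntropy (memDensity 𝒜 i * (1 - memDensity ℬ i)) := by
  have hS : (#𝒜 : ℝ) ≠ 0 := by exact_mod_cast h𝒜.card_pos.ne'
  have hT : (#ℬ : ℝ) ≠ 0 := by exact_mod_cast hℬ.card_pos.ne'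
  -- Once `A` is known, `A \ B` and `B ∩ A` carry the same information.
  have hprod := unifEntropy_product (j := fun x : Finset ι × Finset ι => x.1 \ x.2)
    (g := fun A B => B ∩ A) h𝒜 hℬ ?_
  · rw [← hprod]
    have hsub := unifEntropy_inter_union_le (𝒜 ×ˢ ℬ)
      (fun x : Finset ι × Finset ι => x.1 \ x.2) ∅ univ
    simp only [empty_union, inter_univ, inter_empty] at hsub
    rw [unifEntropy_of_constant (f := fun _ : Finset ι × Finset ι => (∅ : Finset ι))
      (fun _ _ _ _ => rfl), zero_add] at hsub
    refine hsub.trans (le_of_eq (sum_congr rfl fun i _ => ?_))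
    rw [unifEntropy_prop]
    congr 1
    have e : {x ∈ 𝒜 ×ˢ ℬ | i ∈ x.1 \ x.2} = {A ∈ 𝒜 | i ∈ A} ×ˢ {B ∈ ℬ | i ∉ B} := by
      ext ⟨A, B⟩
      simp only [mem_filter, mem_product, mem_sdiff]
      tauto
    have hsum : (#{B ∈ ℬ | i ∈ B} : ℝ) + #{B ∈ ℬ | i ∉ B} = #ℬ := by
      exact_mod_cast card_filter_add_card_filter_not (s := ℬ) (fun B => i ∈ B)
    rw [e, card_product, card_product, Nat.cast_mul, Nat.cast_mul, memDensity, memDensity]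
    field_simp
    linear_combination (#{A ∈ 𝒜 | i ∈ A} : ℝ) * hsum
  · intro A hA B hB A' hA' B' hB'
    constructor
    · intro e
      obtain rfl := h A' hA' A hA B' hB' B hB e
      refine ⟨rfl, ?_⟩
      simp only [Finset.ext_iff, mem_inter, mem_sdiff] at e ⊢
      grind
    · rintro ⟨rfl, e⟩
      simp only [Finset.ext_iff, mem_inter, mem_sdiff] at e ⊢
      grind

/-- The entropy inequality for a recovering pair, with the roles of the families fixed. -/
lemma log_card_add_mul_log_card_le [Fintype ι] {𝒜 ℬ : Finset (Finset ι)} (h𝒜 : 𝒜.Nonempty)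
    (hℬ : ℬ.Nonempty) (h : IsRecoveringPair 𝒜 ℬ) {τ : ℝ} (hτ : 0 ≤ τ) :
    Real.log #𝒜 + τ * Real.log #ℬ ≤
      ∑ i, (Real.binEntropy (memDensity 𝒜 i * (1 - memDensity ℬ i)) +
        max (τ - memDensity 𝒜 i) 0 *
          ((1 - memDensity 𝒜 i) * Real.binEntropy (memDensity ℬ i))) := by
  have h1 := log_card_add_sum_unifEntropy_le h𝒜 hℬ
    fun A hA A' hA' B hB B' hB' => (h A hA A' hA' B hB B' hB').1
  have h2 := mul_log_card_sub_le_sum_unifEntropy_inter h𝒜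
    (log_card_le_unifEntropy_inter h𝒜 hℬ
      fun A hA B hB B' hB' => (h A hA A hA B hB B' hB').2) hτ
  rw [sum_add_distrib]
  linarith

lemma IsRecoveringPair.symm {𝒜 ℬ : Finset (Finset ι)} (h : IsRecoveringPair 𝒜 ℬ) :
    IsRecoveringPair ℬ 𝒜 :=
  fun B hB B' hB' A hA A' hA' => (h A hA A' hA' B hB B' hB').symm

end RecoveringPairs

theorem theorem1p2 (n : ℕ) (𝒜 ℬ : Finset (Finset (Fin n)))
    (h : IsRecoveringPair 𝒜 ℬ) :
    (𝒜.card : ℝ) * (ℬ.card : ℝ) ≤ (2.2543 : ℝ) ^ n := by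
  rcases 𝒜.eq_empty_or_nonempty with rfl | h𝒜
  · simp only [card_empty, Nat.cast_zero, zero_mul]
    positivity
  rcases ℬ.eq_empty_or_nonempty with rfl | hℬ
  · simp only [card_empty, Nat.cast_zero, mul_zero]
    positivity
  have hS : (0 : ℝ) < #𝒜 := by exact_mod_cast h𝒜.card_pos
  have hT : (0 : ℝ) < #ℬ := by exact_mod_cast hℬ.card_pos
  rw [← Real.log_le_log_iff (mul_pos hS hT) (by positivity), Real.log_mul hS.ne' hT.ne',
    Real.log_pow]
  have h1 := log_card_add_mul_log_card_le h𝒜 hℬ h (τ := 1 / 2) (by norm_num)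
  have h2 := log_card_add_mul_log_card_le hℬ h𝒜 h.symm (τ := 1 / 2) (by norm_num)
  have h3 := add_le_add h1 h2
  rw [← sum_add_distrib] at h3
  -- The left side is now `3/2 (log #𝒜 + log #ℬ)`, matching the `3/2` in `single_letter_le`.
  have h4 := h3.trans (sum_le_sum fun i _ => (le_of_eq (by ring)).trans (single_letter_le
    (memDensity_nonneg 𝒜 i) (memDensity_le_one 𝒜 i) (memDensity_nonneg ℬ i)
    (memDensity_le_one ℬ i)))
  rw [sum_const, nsmul_eq_mul, card_univ, Fintype.card_fin] at h4
  linarith
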